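/- Let $\mu$ be a finite positive Borel measure on the unit circle $\partial\mathbb{D}=\{z\in\mathbb{C} : |z|=1\}$, with Lebesgue decomposition $$d\mu(e^{i\theta}) = w(\theta)\,\frac{d\theta}{2\pi} + d\mu_{\mathrm{s}}(e^{i\theta}),$$ where $\mu_{\mathrm{s}}$ is singular with respect to Lebesgue measure on $\partial\mathbb{D}$. Suppose that $w(\theta)>0$ for Lebesgue-a.e. $\theta$. Let $\Phi_n$ ($n\ge 0$) be the monic orthogonal polynomials of $\mu$, obtained by applying the Gram–Schmidt process (without normalization) to $1,z,z^2,\dots$ in $L^2(\partial\mathbb{D},d\mu)$, and let $\varphi_n=\Phi_n/\|\Phi_n\|_{L^2(\partial\mathbb{D},d\mu)}$ be the orthonormal polynomials. Then $$\lim_{n\to\infty}\ \frac{1}{n+1}\int \sum_{j=0}^{n} |\varphi_j(e^{i\theta})|^2\, d\mu_{\mathrm{s}}(\theta) = 0.$$ -/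

import Mathlib

open MeasureTheory Filter Topology Polynomial

noncomputable section

namespace OPUC

/-- The unit circle carries its Borel sigma-algebra. -/
instance instMeasurableSpaceCircle : MeasurableSpace Circle := borel Circle

instance instBorelSpaceCircle : BorelSpace Circle := ⟨rfl⟩

/-- Normalized Lebesgue measure `dθ / 2π` on the unit circle: the image of Lebesgue measure on
`(-π, π]`, divided by `2π`, under `θ ↦ exp (i θ)`. -/
def circleLebesgue : Measure Circle :=
  (ENNReal.ofReal (2 * Real.pi))⁻¹ •
    (volume.restrict (Set.Ioc (-Real.pi) Real.pi)).map (fun θ : ℝ => Circle.exp θ)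

/-- The inner product `⟨p, q⟩ = ∫ conj (p z) * q z dμ(z)` of polynomials in `L²(∂𝔻, μ)`,
conjugate-linear in the first argument. -/
def polyInner (μ : Measure Circle) (p q : ℂ[X]) : ℂ :=
  ∫ z : Circle, (starRingEnd ℂ) (p.eval (z : ℂ)) * q.eval (z : ℂ) ∂μ

/-- The `L²(∂𝔻, μ)` norm of a polynomial. -/
def polyNorm (μ : Measure Circle) (p : ℂ[X]) : ℝ :=
  Real.sqrt (∫ z : Circle, ‖p.eval (z : ℂ)‖ ^ 2 ∂μ)

/-- The monic orthogonal polynomials `Φ_n(z, dμ)`: the Gram-Schmidt process applied to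
`1, z, z², …` in `L²(∂𝔻, μ)`. -/
def monicOPUC (μ : Measure Circle) (n : ℕ) : ℂ[X] :=
  X ^ n - ∑ j : Fin n,
    C (polyInner μ (monicOPUC μ j) (X ^ n) / polyInner μ (monicOPUC μ j) (monicOPUC μ j)) *
      monicOPUC μ j
termination_by n
decreasing_by exact j.isLt

/-- The orthonormal polynomials `φ_n(z, dμ) = Φ_n / ‖Φ_n‖`. -/
def orthonormalOPUC (μ : Measure Circle) (n : ℕ) : ℂ[X] :=
  C (((polyNorm μ (monicOPUC μ n))⁻¹ : ℝ) : ℂ) * monicOPUC μ n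

end OPUC

end

noncomputable section
namespace OPUC

/-! Write m for `circleLebesgue`, N = n + 1 and K for the sum of |φ_j|² over j ≤ n. Since ∫ K dμ =
N, the quantity to bound is 1 - (1/N) ∫ wK dm, so a lower bound for K on the absolutely continuous
part suffices. The Dirichlet kernel D_ζ as trial polynomial gives K(ζ) ≥ 2tN - t² b(ζ) for every
real t, with b(ζ) = ∫ |D_ζ|² dμ (`two_mul_sub_le_sum_norm_orthonormalOPUC_sq`).

Let h ≥ 0 be continuous. Taking t = √(h/w) and integrating against w, the term (1/N) ∫ hb dm is by
Fubini the μ-integral of the Fejér mean of h, which tends to ∫ h dμ = ∫ h dμ_s + ∫ wh dm. What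
remains is at most ∫ |1 - wh| dm + ∫ h dμ_s plus the Fejér error (`integral_singularPart_le`). Both
integrals are small when h is L¹(μ)-close to 1/w off a null set carrying μ_s and to 0 on it
(`exists_continuous_approx_inv_rnDeriv`). -/

/-! ### Lebesgue measure on the circle and Parseval for polynomials. -/

theorem integral_circleLebesgue {f : Circle → ℂ} (hf : Continuous f) :
    ∫ z, f z ∂circleLebesgue =
      ((2 * Real.pi)⁻¹ : ℝ) * ∫ θ in (-Real.pi)..Real.pi, f (Circle.exp θ) := by
  rw [circleLebesgue, integral_smul_measure,
    integral_map Circle.exp.continuous.measurable.aemeasurable hf.aestronglyMeasurable,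
    intervalIntegral.integral_of_le (by linarith [Real.pi_pos]), ENNReal.toReal_inv,
    ENNReal.toReal_ofReal (by positivity), Complex.real_smul]

instance isProbabilityMeasure_circleLebesgue : IsProbabilityMeasure circleLebesgue := by
  constructor
  rw [circleLebesgue, Measure.smul_apply,
    Measure.map_apply Circle.exp.continuous.measurable MeasurableSet.univ, Set.preimage_univ,
    Measure.restrict_apply_univ, Real.volume_Ioc, smul_eq_mul,
    show Real.pi - -Real.pi = 2 * Real.pi by ring]
  exact ENNReal.inv_mul_cancel (by simp [Real.pi_pos]) ENNReal.ofReal_ne_top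

theorem integral_pow_mul_conj_pow (j k : ℕ) :
    ∫ z : Circle, (z : ℂ) ^ j * (starRingEnd ℂ) ((z : ℂ) ^ k) ∂circleLebesgue =
      if j = k then 1 else 0 := by
  rw [integral_circleLebesgue (by fun_prop)]
  have key : ∀ θ : ℝ, (Circle.exp θ : ℂ) ^ j * (starRingEnd ℂ) ((Circle.exp θ : ℂ) ^ k) =
      Complex.exp (((j : ℂ) - k) * Complex.I * θ) := by
    intro θ
    rw [Circle.coe_exp, ← Complex.exp_nat_mul, ← Complex.exp_nat_mul, ← Complex.exp_conj,
      ← Complex.exp_add]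
    congr 1
    simp only [map_mul, map_natCast, Complex.conj_ofReal, Complex.conj_I]
    ring
  simp_rw [key]
  have hpi : (Real.pi : ℂ) ≠ 0 := by exact_mod_cast Real.pi_ne_zero
  split_ifs with h
  · subst h
    simp
    field_simp
    norm_num
  · have hc : ((j : ℂ) - k) * Complex.I ≠ 0 :=
      mul_ne_zero (sub_ne_zero.2 (by exact_mod_cast h)) Complex.I_ne_zero
    rw [integral_exp_mul_complex hc]
    have : Complex.exp (((j : ℂ) - k) * Complex.I * (Real.pi : ℝ)) =
        Complex.exp (((j : ℂ) - k) * Complex.I * ((-Real.pi : ℝ) : ℂ)) := by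
      rw [Complex.exp_eq_exp_iff_exists_int]
      refine ⟨(j : ℤ) - k, ?_⟩
      push_cast
      ring
    rw [this]
    simp

theorem integrable_of_continuous {E : Type*} [NormedAddCommGroup E] {μ : Measure Circle}
    [IsFiniteMeasure μ] {f : Circle → E} (hf : Continuous f) : Integrable f μ :=
  hf.integrable_of_hasCompactSupport (HasCompactSupport.of_compactSpace f)

theorem integral_norm_sum_pow_sq (N : ℕ) (a : ℕ → ℂ) :
    ∫ z : Circle, ‖∑ j ∈ Finset.range N, a j * (z : ℂ) ^ j‖ ^ 2 ∂circleLebesgue =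
      ∑ j ∈ Finset.range N, ‖a j‖ ^ 2 := by
  have h1 : ∀ z : Circle, ((‖∑ j ∈ Finset.range N, a j * (z : ℂ) ^ j‖ ^ 2 : ℝ) : ℂ) =
      ∑ j ∈ Finset.range N, ∑ k ∈ Finset.range N,
        (a j * (starRingEnd ℂ) (a k)) * ((z : ℂ) ^ j * (starRingEnd ℂ) ((z : ℂ) ^ k)) := by
    intro z
    push_cast
    rw [← Complex.mul_conj', map_sum, Finset.sum_mul_sum]
    refine Finset.sum_congr rfl fun j _ => Finset.sum_congr rfl fun k _ => ?_
    rw [map_mul]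
    ring
  apply Complex.ofReal_injective
  rw [← integral_complex_ofReal]
  simp_rw [h1]
  rw [integral_finsetSum _ fun j _ => integrable_of_continuous (by fun_prop)]
  push_cast
  refine Finset.sum_congr rfl fun j hj => ?_
  rw [integral_finsetSum _ fun k _ => integrable_of_continuous (by fun_prop)]
  simp_rw [integral_const_mul, integral_pow_mul_conj_pow]
  rw [Finset.sum_eq_single j (fun k _ hk => by simp [Ne.symm hk]) (fun h => absurd hj h)]
  simp [Complex.mul_conj']

/-! ### Dirichlet polynomials and Fejér means. -/

/-- The polynomial `∑ j ≤ n, (conj ζ * z) ^ j` in `z`, whose square modulus on the circle is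
`n + 1` times the Fejér kernel at `z / ζ`. -/
def dirichletPoly (n : ℕ) (ζ : Circle) : ℂ[X] :=
  ∑ j ∈ Finset.range (n + 1), C ((starRingEnd ℂ) (ζ : ℂ) ^ j) * X ^ j

theorem eval_dirichletPoly (n : ℕ) (ζ z : Circle) :
    (dirichletPoly n ζ).eval (z : ℂ) =
      ∑ j ∈ Finset.range (n + 1), ((starRingEnd ℂ) (ζ : ℂ) * z) ^ j := by
  simp [dirichletPoly, eval_finsetSum, mul_pow]

theorem conj_mul_self_circle (ζ : Circle) : (starRingEnd ℂ) (ζ : ℂ) * ζ = 1 := by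
  simp [Complex.conj_mul', Circle.norm_coe]

theorem eval_dirichletPoly_self (n : ℕ) (ζ : Circle) :
    (dirichletPoly n ζ).eval (ζ : ℂ) = n + 1 := by
  simp [eval_dirichletPoly, conj_mul_self_circle]

theorem continuous_dirichletPoly (n : ℕ) :
    Continuous fun p : Circle × Circle => ‖(dirichletPoly n p.1).eval (p.2 : ℂ)‖ ^ 2 := by
  simp_rw [eval_dirichletPoly]
  fun_prop

theorem integral_norm_dirichletPoly_sq (n : ℕ) (z : Circle) :
    ∫ ζ : Circle, ‖(dirichletPoly n ζ).eval (z : ℂ)‖ ^ 2 ∂circleLebesgue = n + 1 := by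
  have : ∀ ζ : Circle, ‖(dirichletPoly n ζ).eval (z : ℂ)‖ =
      ‖∑ j ∈ Finset.range (n + 1), (starRingEnd ℂ) (z : ℂ) ^ j * (ζ : ℂ) ^ j‖ := by
    intro ζ
    -- Conjugation swaps the roles of ζ and z, so Parseval applies in ζ.
    rw [← RCLike.norm_conj, eval_dirichletPoly, map_sum]
    simp [mul_pow, mul_comm]
  simp_rw [this]
  rw [integral_norm_sum_pow_sq]
  simp [Circle.norm_coe]

/-- The geometric sum telescopes to a difference of two unimodular numbers; this gives decay of the
kernel off the diagonal. -/
theorem norm_sub_sq_mul_norm_dirichletPoly_sq_le (n : ℕ) (ζ z : Circle) :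
    ‖(ζ : ℂ) - z‖ ^ 2 * ‖(dirichletPoly n ζ).eval (z : ℂ)‖ ^ 2 ≤ 4 := by
  have h1 : ‖(ζ : ℂ) - z‖ = ‖(starRingEnd ℂ) (ζ : ℂ) * z - 1‖ := by
    rw [← conj_mul_self_circle ζ, ← mul_sub, norm_mul, RCLike.norm_conj, Circle.norm_coe,
      one_mul, norm_sub_rev]
  rw [← mul_pow, h1, ← norm_mul, eval_dirichletPoly, mul_comm, geom_sum_mul]
  have h2 : ‖((starRingEnd ℂ) (ζ : ℂ) * z) ^ (n + 1) - 1‖ ≤ 2 := by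
    refine (norm_sub_le _ _).trans ?_
    simp only [norm_pow, norm_mul, RCLike.norm_conj, Circle.norm_coe, norm_one]
    norm_num
  calc _ ≤ (2 : ℝ) ^ 2 := by gcongr
    _ = 4 := by norm_num

/-- Fejér's theorem in the form: Cesàro means converge uniformly for continuous functions. -/
theorem eventually_fejer_le {h : Circle → ℝ} (hc : Continuous h) {ε : ℝ} (hε : 0 < ε) :
    ∀ᶠ n : ℕ in atTop, ∀ z : Circle,
      1 / ((n : ℝ) + 1) * ∫ ζ : Circle, h ζ * ‖(dirichletPoly n ζ).eval (z : ℂ)‖ ^ 2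
        ∂circleLebesgue ≤ h z + ε := by
  obtain ⟨M, hM⟩ := isCompact_univ.exists_bound_of_continuousOn hc.continuousOn
  have hM0 : 0 ≤ M := (norm_nonneg _).trans (hM 1 trivial)
  obtain ⟨δ, hδ, hunif⟩ := Metric.uniformContinuous_iff.1
    (CompactSpace.uniformContinuous_of_continuous hc) (ε / 2) (by positivity)
  have hlim : Tendsto (fun n : ℕ => 8 * M / δ ^ 2 * (1 / ((n : ℝ) + 1))) atTop (𝓝 0) := by
    simpa only [mul_zero] using
      (tendsto_one_div_add_atTop_nhds_zero_nat (𝕜 := ℝ)).const_mul (8 * M / δ ^ 2)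
  filter_upwards [hlim.eventually (gt_mem_nhds (half_pos hε))] with n hn z
  -- Near z, uniform continuity gives the first term. Far from z, h varies by at most 2M and the
  -- squared kernel is at most 4 / δ², whence 8M / δ².
  have hpt : ∀ ζ : Circle, h ζ * ‖(dirichletPoly n ζ).eval (z : ℂ)‖ ^ 2 ≤
      (h z + ε / 2) * ‖(dirichletPoly n ζ).eval (z : ℂ)‖ ^ 2 + 8 * M / δ ^ 2 := by
    intro ζ
    have hb := norm_sub_sq_mul_norm_dirichletPoly_sq_le n ζ z
    set D := ‖(dirichletPoly n ζ).eval (z : ℂ)‖ ^ 2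
    have hD : 0 ≤ D := by positivity
    rcases lt_or_ge (dist ζ z) δ with hd | hd
    · have h1 := hunif hd
      rw [Real.dist_eq] at h1
      have h2 : h ζ ≤ h z + ε / 2 := by linarith [(abs_lt.1 h1).2]
      have h3 : 0 ≤ 8 * M / δ ^ 2 := by positivity
      nlinarith
    · have h1 := abs_le.1 (hM ζ trivial)
      have h2 := abs_le.1 (hM z trivial)
      have hd' : δ ≤ ‖(ζ : ℂ) - z‖ := by rwa [← dist_eq_norm]
      have h3 : D ≤ 4 / δ ^ 2 := by
        rw [le_div_iff₀ (by positivity)]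
        have : δ ^ 2 ≤ ‖(ζ : ℂ) - z‖ ^ 2 := by gcongr
        nlinarith
      have h4 : 2 * M * D ≤ 8 * M / δ ^ 2 := by
        calc 2 * M * D ≤ 2 * M * (4 / δ ^ 2) := by gcongr
          _ = _ := by ring
      nlinarith
  have hDc : Continuous fun ζ : Circle => ‖(dirichletPoly n ζ).eval (z : ℂ)‖ ^ 2 :=
    (continuous_dirichletPoly n).comp (by fun_prop : Continuous fun ζ : Circle => (ζ, z))
  have hint : ∫ ζ : Circle, h ζ * ‖(dirichletPoly n ζ).eval (z : ℂ)‖ ^ 2 ∂circleLebesgue ≤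
      ∫ ζ : Circle, ((h z + ε / 2) * ‖(dirichletPoly n ζ).eval (z : ℂ)‖ ^ 2 + 8 * M / δ ^ 2)
        ∂circleLebesgue :=
    integral_mono (integrable_of_continuous (hc.mul hDc))
      (integrable_of_continuous ((continuous_const.mul hDc).add continuous_const)) hpt
  have hi : Integrable (fun ζ : Circle =>
      (h z + ε / 2) * ‖(dirichletPoly n ζ).eval (z : ℂ)‖ ^ 2) circleLebesgue :=
    integrable_of_continuous (continuous_const.mul hDc)
  rw [integral_add hi (integrable_const _),
    integral_const_mul, integral_norm_dirichletPoly_sq, integral_const] at hint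
  simp only [probReal_univ, one_smul] at hint
  have hn0 : (0 : ℝ) < n + 1 := by positivity
  calc _ ≤ 1 / ((n : ℝ) + 1) * ((h z + ε / 2) * (n + 1) + 8 * M / δ ^ 2) := by gcongr
    _ = h z + ε / 2 + 8 * M / δ ^ 2 * (1 / ((n : ℝ) + 1)) := by field_simp
    _ ≤ h z + ε := by linarith

/-! ### Sesquilinearity of `polyInner`. -/

section Inner
variable (μ : Measure Circle)

theorem continuous_eval_circle (p : ℂ[X]) : Continuous fun z : Circle => p.eval (z : ℂ) :=
  p.continuous.comp continuous_subtype_val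

theorem integrable_polyInner [IsFiniteMeasure μ] (p q : ℂ[X]) :
    Integrable (fun z : Circle => (starRingEnd ℂ) (p.eval (z : ℂ)) * q.eval (z : ℂ)) μ :=
  integrable_of_continuous ((Complex.continuous_conj.comp (continuous_eval_circle p)).mul
    (continuous_eval_circle q))

theorem polyInner_sub_right [IsFiniteMeasure μ] (p q r : ℂ[X]) :
    polyInner μ p (q - r) = polyInner μ p q - polyInner μ p r := by
  simp only [polyInner, eval_sub, mul_sub]
  exact integral_sub (integrable_polyInner μ p q) (integrable_polyInner μ p r)

theorem polyInner_sum_right [IsFiniteMeasure μ] {ι : Type*} (s : Finset ι) (p : ℂ[X])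
    (q : ι → ℂ[X]) : polyInner μ p (∑ i ∈ s, q i) = ∑ i ∈ s, polyInner μ p (q i) := by
  simp only [polyInner, eval_finsetSum, Finset.mul_sum]
  exact integral_finsetSum _ fun i _ => integrable_polyInner μ p (q i)

theorem polyInner_C_mul_right (c : ℂ) (p q : ℂ[X]) :
    polyInner μ p (C c * q) = c * polyInner μ p q := by
  simp only [polyInner, eval_mul, eval_C]
  rw [← integral_const_mul]
  congr 1 with z
  ring

theorem conj_polyInner (p q : ℂ[X]) :
    (starRingEnd ℂ) (polyInner μ p q) = polyInner μ q p := by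
  simp only [polyInner]
  rw [← integral_conj]
  congr 1 with z
  simp [mul_comm]

theorem polyInner_C_mul_left (c : ℂ) (p q : ℂ[X]) :
    polyInner μ (C c * p) q = (starRingEnd ℂ) c * polyInner μ p q := by
  rw [← conj_polyInner, polyInner_C_mul_right, map_mul, conj_polyInner]

theorem polyInner_sum_left [IsFiniteMeasure μ] {ι : Type*} (s : Finset ι) (p : ℂ[X])
    (q : ι → ℂ[X]) : polyInner μ (∑ i ∈ s, q i) p = ∑ i ∈ s, polyInner μ (q i) p := by
  rw [← conj_polyInner, polyInner_sum_right, map_sum]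
  simp_rw [conj_polyInner]

theorem polyInner_self (p : ℂ[X]) :
    polyInner μ p p = ((∫ z : Circle, ‖p.eval (z : ℂ)‖ ^ 2 ∂μ : ℝ) : ℂ) := by
  rw [← integral_complex_ofReal, polyInner]
  congr 1 with z
  rw [Complex.conj_mul']
  push_cast
  rfl

theorem polyInner_self_eq_polyNorm_sq (p : ℂ[X]) :
    polyInner μ p p = ((polyNorm μ p ^ 2 : ℝ) : ℂ) := by
  rw [polyInner_self, polyNorm, Real.sq_sqrt (integral_nonneg fun _ => by positivity)]

end Inner

/-! ### Gram–Schmidt, orthonormality and the extremal bound. -/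

theorem monicOPUC_eq (μ : Measure Circle) (n : ℕ) :
    monicOPUC μ n = X ^ n - ∑ j ∈ Finset.range n,
      C (polyInner μ (monicOPUC μ j) (X ^ n) / polyInner μ (monicOPUC μ j) (monicOPUC μ j)) *
        monicOPUC μ j := by
  rw [monicOPUC, Finset.sum_range]

theorem degree_monicOPUC_sum_lt (μ : Measure Circle) (n : ℕ) (c : ℕ → ℂ)
    (h : ∀ j < n, (monicOPUC μ j).degree = j) :
    (∑ j ∈ Finset.range n, C (c j) * monicOPUC μ j).degree < n := by
  rw [← mem_degreeLT]
  refine Submodule.sum_mem _ fun j hj => ?_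
  rw [← smul_eq_C_mul]
  refine Submodule.smul_mem _ _ ?_
  rw [mem_degreeLT, h j (Finset.mem_range.1 hj)]
  exact_mod_cast Finset.mem_range.1 hj

theorem degree_monicOPUC (μ : Measure Circle) (n : ℕ) : (monicOPUC μ n).degree = n := by
  induction n using Nat.strong_induction_on with
  | _ n ih =>
    rw [monicOPUC_eq, degree_sub_eq_left_of_degree_lt] <;> rw [degree_X_pow]
    exact degree_monicOPUC_sum_lt μ n _ ih

theorem monicOPUC_ne_zero (μ : Measure Circle) (n : ℕ) : monicOPUC μ n ≠ 0 := by
  intro h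
  have := degree_monicOPUC μ n
  rw [h] at this
  simp at this

section Nondegenerate
variable {μ : Measure Circle} [IsFiniteMeasure μ]

/-- By Parseval, a polynomial vanishing a.e. has zero leading coefficient. -/
theorem ae_circleLebesgue_ne_zero {p : ℂ[X]} (hp : p ≠ 0) :
    ¬ ∀ᵐ z : Circle ∂circleLebesgue, p.eval (z : ℂ) = 0 := by
  intro h
  have h1 := integral_norm_sum_pow_sq (p.natDegree + 1) p.coeff
  simp_rw [← eval_eq_sum_range] at h1
  have h2 : ∫ z : Circle, ‖p.eval (z : ℂ)‖ ^ 2 ∂circleLebesgue = 0 := by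
    rw [integral_eq_zero_of_ae]
    filter_upwards [h] with z hz
    simp [hz]
  rw [h2, eq_comm, Finset.sum_eq_zero_iff_of_nonneg fun _ _ => by positivity] at h1
  have := h1 p.natDegree (by simp)
  simp [hp] at this

theorem polyInner_self_ne_zero (hμ : circleLebesgue ≪ μ) {p : ℂ[X]} (hp : p ≠ 0) :
    polyInner μ p p ≠ 0 := by
  rw [polyInner_self]
  intro h
  have hi : Integrable (fun z : Circle => ‖p.eval (z : ℂ)‖ ^ 2) μ :=
    integrable_of_continuous ((continuous_eval_circle p).norm.pow 2)
  rw [Complex.ofReal_eq_zero, integral_eq_zero_iff_of_nonneg (fun _ => by positivity) hi] at h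
  refine ae_circleLebesgue_ne_zero hp (hμ.ae_le ?_)
  filter_upwards [h] with z hz
  simpa using hz

theorem polyInner_monicOPUC_of_lt (hμ : circleLebesgue ≪ μ) (n : ℕ) :
    ∀ j < n, polyInner μ (monicOPUC μ j) (monicOPUC μ n) = 0 := by
  induction n using Nat.strong_induction_on with
  | _ n ih =>
    intro j hj
    rw [monicOPUC_eq μ n, polyInner_sub_right, polyInner_sum_right]
    simp_rw [polyInner_C_mul_right]
    rw [Finset.sum_eq_single j, div_mul_cancel₀ _
      (polyInner_self_ne_zero hμ (monicOPUC_ne_zero μ j)), sub_self]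
    · intro k hk hkj
      rcases lt_or_gt_of_ne hkj with h | h
      · rw [← conj_polyInner μ (monicOPUC μ k) (monicOPUC μ j), ih j hj k h, map_zero, mul_zero]
      · rw [ih k (Finset.mem_range.1 hk) j h, mul_zero]
    · intro h
      exact absurd (Finset.mem_range.2 hj) h

theorem polyInner_orthonormalOPUC (hμ : circleLebesgue ≪ μ) (j k : ℕ) :
    polyInner μ (orthonormalOPUC μ j) (orthonormalOPUC μ k) = if j = k then 1 else 0 := by
  rw [orthonormalOPUC, orthonormalOPUC, polyInner_C_mul_left, polyInner_C_mul_right]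
  split_ifs with h
  · subst h
    have h0 := polyInner_self_ne_zero hμ (monicOPUC_ne_zero μ j)
    rw [polyInner_self_eq_polyNorm_sq] at h0 ⊢
    have h1 : polyNorm μ (monicOPUC μ j) ≠ 0 := by
      intro h
      simp [h] at h0
    rw [Complex.conj_ofReal]
    norm_cast
    field_simp
  · have : polyInner μ (monicOPUC μ j) (monicOPUC μ k) = 0 := by
      rcases lt_or_gt_of_ne h with h | h
      · exact polyInner_monicOPUC_of_lt hμ k j h
      · rw [← conj_polyInner, polyInner_monicOPUC_of_lt hμ j k h, map_zero]
    simp [this]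

theorem integral_norm_orthonormalOPUC_sq (hμ : circleLebesgue ≪ μ) (j : ℕ) :
    ∫ z : Circle, ‖(orthonormalOPUC μ j).eval (z : ℂ)‖ ^ 2 ∂μ = 1 := by
  have := polyInner_orthonormalOPUC hμ j j
  rw [polyInner_self, if_pos rfl] at this
  exact_mod_cast this

theorem monicOPUC_eq_C_mul_orthonormalOPUC (hμ : circleLebesgue ≪ μ) (j : ℕ) :
    monicOPUC μ j = C ((polyNorm μ (monicOPUC μ j) : ℝ) : ℂ) * orthonormalOPUC μ j := by
  have h0 := polyInner_self_ne_zero hμ (monicOPUC_ne_zero μ j)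
  rw [polyInner_self_eq_polyNorm_sq] at h0
  have h1 : ((polyNorm μ (monicOPUC μ j) : ℝ) : ℂ) ≠ 0 := by
    intro h
    rw [Complex.ofReal_eq_zero] at h
    simp [h] at h0
  rw [orthonormalOPUC, ← mul_assoc, ← C_mul, Complex.ofReal_inv, mul_inv_cancel₀ h1, C_1, one_mul]

theorem X_pow_mem_span_orthonormalOPUC (hμ : circleLebesgue ≪ μ) {k n : ℕ} (hk : k ≤ n) :
    (X ^ k : ℂ[X]) ∈
      Submodule.span ℂ (orthonormalOPUC μ '' (Finset.range (n + 1) : Set ℕ)) := by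
  have hm : ∀ j ≤ n, monicOPUC μ j ∈
      Submodule.span ℂ (orthonormalOPUC μ '' (Finset.range (n + 1) : Set ℕ)) := by
    intro j hj
    rw [monicOPUC_eq_C_mul_orthonormalOPUC hμ j, ← smul_eq_C_mul]
    exact Submodule.smul_mem _ _
      (Submodule.subset_span ⟨j, by simpa [Nat.lt_succ_iff] using hj, rfl⟩)
  rw [sub_eq_iff_eq_add.1 (monicOPUC_eq μ k).symm]
  refine Submodule.add_mem _ (hm k hk) (Submodule.sum_mem _ fun j hj => ?_)
  rw [← smul_eq_C_mul]
  exact Submodule.smul_mem _ _ (hm j ((Finset.mem_range.1 hj).le.trans hk))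

theorem exists_eq_sum_orthonormalOPUC (hμ : circleLebesgue ≪ μ) (n : ℕ) (a : ℕ → ℂ) :
    ∃ c : ℕ → ℂ, ∑ j ∈ Finset.range (n + 1), C (a j) * X ^ j =
      ∑ j ∈ Finset.range (n + 1), C (c j) * orthonormalOPUC μ j := by
  have : (∑ j ∈ Finset.range (n + 1), C (a j) * X ^ j : ℂ[X]) ∈
      Submodule.span ℂ (orthonormalOPUC μ '' (Finset.range (n + 1) : Set ℕ)) := by
    refine Submodule.sum_mem _ fun j hj => ?_
    rw [← smul_eq_C_mul]
    exact Submodule.smul_mem _ _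
      (X_pow_mem_span_orthonormalOPUC hμ (Nat.lt_succ_iff.1 (Finset.mem_range.1 hj)))
  obtain ⟨c, hc⟩ := (Submodule.mem_span_image_finset_iff_exists_fun ℂ).1 this
  refine ⟨fun j => if h : j ∈ Finset.range (n + 1) then c ⟨j, h⟩ else 0, ?_⟩
  rw [← hc, Finset.sum_coe_sort_eq_attach, ← Finset.sum_attach (Finset.range (n + 1))]
  refine Finset.sum_congr rfl fun j _ => ?_
  simp only [Finset.coe_mem, dif_pos, smul_eq_C_mul]

theorem integral_norm_sum_orthonormalOPUC_sq (hμ : circleLebesgue ≪ μ) (n : ℕ) (c : ℕ → ℂ) :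
    ∫ z : Circle, ‖(∑ j ∈ Finset.range n, C (c j) * orthonormalOPUC μ j).eval (z : ℂ)‖ ^ 2 ∂μ =
      ∑ j ∈ Finset.range n, ‖c j‖ ^ 2 := by
  apply Complex.ofReal_injective
  rw [← polyInner_self, polyInner_sum_right]
  push_cast
  refine Finset.sum_congr rfl fun j hj => ?_
  rw [polyInner_sum_left, Finset.sum_eq_single j]
  · rw [polyInner_C_mul_left, polyInner_C_mul_right, polyInner_orthonormalOPUC hμ, if_pos rfl,
      mul_one, Complex.conj_mul']
  · intro k _ hk
    rw [polyInner_C_mul_left, polyInner_C_mul_right, polyInner_orthonormalOPUC hμ, if_neg hk,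
      mul_zero, mul_zero]
  · intro h
    exact absurd hj h

/-- Linearized form of the extremal property of the Christoffel function, with the Dirichlet
kernel as trial polynomial. -/
theorem two_mul_sub_le_sum_norm_orthonormalOPUC_sq (hμ : circleLebesgue ≪ μ) (n : ℕ)
    (ζ : Circle) (t : ℝ) :
    2 * t * (n + 1) - t ^ 2 * ∫ z : Circle, ‖(dirichletPoly n ζ).eval (z : ℂ)‖ ^ 2 ∂μ ≤
      ∑ j ∈ Finset.range (n + 1), ‖(orthonormalOPUC μ j).eval (ζ : ℂ)‖ ^ 2 := by
  obtain ⟨c, hc⟩ := exists_eq_sum_orthonormalOPUC hμ n fun j => (starRingEnd ℂ) (ζ : ℂ) ^ j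
  have h1 : (n : ℂ) + 1 =
      ∑ j ∈ Finset.range (n + 1), c j * (orthonormalOPUC μ j).eval (ζ : ℂ) := by
    rw [← eval_dirichletPoly_self n ζ, dirichletPoly, hc]
    simp [eval_finsetSum]
  have h2 : (n : ℝ) + 1 =
      ∑ j ∈ Finset.range (n + 1), (c j * (orthonormalOPUC μ j).eval (ζ : ℂ)).re := by
    rw [← Complex.re_sum, ← h1]
    simp
  rw [dirichletPoly, hc, integral_norm_sum_orthonormalOPUC_sq hμ, h2, Finset.mul_sum,
    Finset.mul_sum, ← Finset.sum_sub_distrib]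
  refine Finset.sum_le_sum fun j _ => ?_
  generalize (orthonormalOPUC μ j).eval (ζ : ℂ) = u
  have h3 : |(c j * u).re| ≤ ‖c j‖ * ‖u‖ := (Complex.abs_re_le_norm _).trans (norm_mul _ _).le
  have h4 : t * (c j * u).re ≤ |t| * (‖c j‖ * ‖u‖) := by
    calc _ ≤ |t * (c j * u).re| := le_abs_self _
      _ = |t| * |(c j * u).re| := abs_mul _ _
      _ ≤ _ := by gcongr
  -- Termwise this is 2xy ≤ x² + y² with x = |t|‖c j‖ and y = ‖u‖.
  nlinarith [sq_nonneg (|t| * ‖c j‖ - ‖u‖), sq_abs t]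

end Nondegenerate
-- Lebesgue decomposition and approximation of 1/w.
theorem absolutelyContinuous_of_rnDeriv_pos {μ : Measure Circle}
    (hw : ∀ᵐ z ∂circleLebesgue, 0 < μ.rnDeriv circleLebesgue z) : circleLebesgue ≪ μ := by
  have h1 : circleLebesgue ≪ circleLebesgue.withDensity (μ.rnDeriv circleLebesgue) :=
    withDensity_absolutelyContinuous' (Measure.measurable_rnDeriv _ _).aemeasurable
      (hw.mono fun _ h => h.ne')
  exact h1.trans (Measure.absolutelyContinuous_of_le (Measure.withDensity_rnDeriv_le _ _))

section Decomposition
variable {μ : Measure Circle} [IsFiniteMeasure μ]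

theorem integrable_withDensity_rnDeriv_iff {f : Circle → ℝ} :
    Integrable f (circleLebesgue.withDensity (μ.rnDeriv circleLebesgue)) ↔
      Integrable (fun z => (μ.rnDeriv circleLebesgue z).toReal * f z) circleLebesgue :=
  integrable_withDensity_iff_integrable_smul' (Measure.measurable_rnDeriv _ _)
    (Measure.rnDeriv_lt_top _ _)

theorem integrable_iff_rnDeriv {f : Circle → ℝ} :
    Integrable f μ ↔ Integrable f (μ.singularPart circleLebesgue) ∧
      Integrable (fun z => (μ.rnDeriv circleLebesgue z).toReal * f z) circleLebesgue := by
  conv_lhs => rw [← Measure.singularPart_add_rnDeriv μ circleLebesgue]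
  rw [integrable_add_measure, integrable_withDensity_rnDeriv_iff]

theorem integral_eq_singularPart_add {f : Circle → ℝ} (hf : Integrable f μ) :
    ∫ z, f z ∂μ = ∫ z, f z ∂(μ.singularPart circleLebesgue) +
      ∫ z, (μ.rnDeriv circleLebesgue z).toReal * f z ∂circleLebesgue := by
  have h := integrable_iff_rnDeriv.1 hf
  conv_lhs => rw [← Measure.singularPart_add_rnDeriv μ circleLebesgue]
  rw [integral_add_measure h.1 (integrable_withDensity_rnDeriv_iff.2 h.2),
    integral_withDensity_eq_integral_toReal_smul (Measure.measurable_rnDeriv _ _)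
      (Measure.rnDeriv_lt_top _ _)]
  rfl

/-- Some nonnegative continuous function approximates, in `L¹(μ)`, the function that is `1 / w`
off the support of the singular part and `0` on it. -/
theorem exists_continuous_approx_inv_rnDeriv
    (hw : ∀ᵐ z ∂circleLebesgue, 0 < μ.rnDeriv circleLebesgue z) {ε : ℝ} (hε : 0 < ε) :
    ∃ h : Circle → ℝ, Continuous h ∧ (∀ z, 0 ≤ h z) ∧
      ∫ z, |1 - (μ.rnDeriv circleLebesgue z).toReal * h z| ∂circleLebesgue +
        ∫ z, h z ∂(μ.singularPart circleLebesgue) ≤ ε := by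
  obtain ⟨S, hS, hS1, hS2⟩ := Measure.mutuallySingular_singularPart μ circleLebesgue
  set H : Circle → ℝ := S.indicator fun z => (μ.rnDeriv circleLebesgue z).toReal⁻¹ with hH
  have hHm : Measurable H := (Measure.measurable_rnDeriv _ _).ennreal_toReal.inv.indicator hS
  have hH0 : ∀ z, 0 ≤ H z := fun z => Set.indicator_nonneg (fun _ _ => by positivity) z
  have hHν : ∀ᵐ z ∂(μ.singularPart circleLebesgue), H z = 0 := by
    filter_upwards [measure_eq_zero_iff_ae_notMem.1 hS1] with z hz
    exact Set.indicator_of_notMem hz _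
  have hHw : ∀ᵐ z ∂circleLebesgue, (μ.rnDeriv circleLebesgue z).toReal * H z = 1 := by
    filter_upwards [hw, Measure.rnDeriv_lt_top μ circleLebesgue,
      measure_eq_zero_iff_ae_notMem.1 hS2] with z h1 h2 h3
    rw [hH, Set.indicator_of_mem (by simpa using h3),
      mul_inv_cancel₀ (ENNReal.toReal_pos h1.ne' h2.ne).ne']
  -- 1/w need not be m-integrable, but w · (1/w) = 1 is, and H vanishes μ_s-a.e.
  have hHi : Integrable H μ := by
    refine integrable_iff_rnDeriv.2 ⟨(integrable_zero _ _ _).congr (hHν.mono fun _ h => h.symm), ?_⟩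
    exact (integrable_const (1 : ℝ)).congr (hHw.mono fun _ h => h.symm)
  obtain ⟨g, hg, hgi⟩ := hHi.exists_boundedContinuous_integral_sub_le hε
  -- As H ≥ 0, taking the positive part does not increase the distance to H.
  have hgc : Continuous fun z => max (g z) 0 := g.continuous.max continuous_const
  refine ⟨fun z => max (g z) 0, hgc, fun _ => le_max_right _ _, ?_⟩
  have hi : Integrable (fun z => |H z - max (g z) 0|) μ :=
    (hHi.sub (integrable_of_continuous hgc)).abs
  have h1 : ∫ z, |H z - max (g z) 0| ∂μ ≤ ε := by
    refine (integral_mono hi (hHi.sub hgi).norm fun z => ?_).trans hg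
    have := hH0 z
    simp only [Pi.sub_apply, Real.norm_eq_abs]
    rcases le_total (g z) 0 with h | h
    · rw [max_eq_right h, abs_of_nonneg (by linarith), abs_of_nonneg (by linarith)]
      linarith
    · rw [max_eq_left h]
  rw [integral_eq_singularPart_add hi, add_comm] at h1
  refine le_trans (le_of_eq ?_) h1
  congr 1
  · refine integral_congr_ae ?_
    filter_upwards [hHw] with z hz
    rw [← hz, ← mul_sub, abs_mul, abs_of_nonneg ENNReal.toReal_nonneg]
  · refine integral_congr_ae ?_
    filter_upwards [hHν] with z hz
    rw [hz, zero_sub, abs_neg, abs_of_nonneg (le_max_right _ _)]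

/-! ### Integrated lower bound for the Christoffel–Darboux kernel. -/

/-- The left side is 2 min(1, s²). It trades √(wh) for terms linear in wh, which can be compared
with ∫ h dμ. -/
theorem one_sub_abs_add_sq_le_two_mul {s : ℝ} (hs : 0 ≤ s) : 1 - |1 - s ^ 2| + s ^ 2 ≤ 2 * s := by
  rcases abs_cases (1 - s ^ 2) with ⟨h, h'⟩ | ⟨h, h'⟩ <;> rw [h] <;> nlinarith

theorem one_sub_abs_add_sub_le {w h b K N : ℝ} (hw : 0 ≤ w) (hh : 0 ≤ h) (hb : 0 ≤ b)
    (hN : 0 < N) (hK : ∀ t : ℝ, 2 * t * N - t ^ 2 * b ≤ K) :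
    1 - |1 - w * h| + w * h - 1 / N * (h * b) ≤ 1 / N * (w * K) := by
  rcases hw.eq_or_lt with rfl | hw
  · have : 0 ≤ 1 / N * (h * b) := by positivity
    simpa using this
  · have h1 := one_sub_abs_add_sq_le_two_mul (Real.sqrt_nonneg (w * h))
    rw [Real.sq_sqrt (by positivity)] at h1
    -- This t is √(h/w): then wt = √(wh) and wt²b = hb, so w disappears from the error term.
    have h2 := mul_le_mul_of_nonneg_left (hK (Real.sqrt (w * h) / w))
      (by positivity : 0 ≤ 1 / N * w)
    have h3 : 1 / N * w * (2 * (Real.sqrt (w * h) / w) * N - (Real.sqrt (w * h) / w) ^ 2 * b) =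
        2 * Real.sqrt (w * h) - 1 / N * (h * b) := by
      rw [div_pow, Real.sq_sqrt (by positivity)]
      field_simp
    rw [h3] at h2
    linarith

theorem continuous_fejer_integrand {h : Circle → ℝ} (hc : Continuous h) (n : ℕ) :
    Continuous fun p : Circle × Circle =>
      h p.1 * ‖(dirichletPoly n p.1).eval (p.2 : ℂ)‖ ^ 2 :=
  (hc.comp continuous_fst).mul (continuous_dirichletPoly n)

theorem integrable_fejer_integrand {h : Circle → ℝ} (hc : Continuous h) (n : ℕ) :
    Integrable (fun p : Circle × Circle =>
      h p.1 * ‖(dirichletPoly n p.1).eval (p.2 : ℂ)‖ ^ 2) (circleLebesgue.prod μ) :=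
  (continuous_fejer_integrand hc n).integrable_of_hasCompactSupport
    (HasCompactSupport.of_compactSpace _)

theorem integral_singularPart_le
    (hw : ∀ᵐ z ∂circleLebesgue, 0 < μ.rnDeriv circleLebesgue z) {h : Circle → ℝ}
    (hc : Continuous h) (h0 : ∀ z, 0 ≤ h z) (n : ℕ) :
    1 / ((n : ℝ) + 1) * ∫ z : Circle, ∑ j ∈ Finset.range (n + 1),
        ‖(orthonormalOPUC μ j).eval (z : ℂ)‖ ^ 2 ∂(μ.singularPart circleLebesgue) ≤
      ∫ z, |1 - (μ.rnDeriv circleLebesgue z).toReal * h z| ∂circleLebesgue +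
        ∫ z, h z ∂(μ.singularPart circleLebesgue) +
      (∫ z : Circle, 1 / ((n : ℝ) + 1) * ∫ ζ : Circle,
        h ζ * ‖(dirichletPoly n ζ).eval (z : ℂ)‖ ^ 2 ∂circleLebesgue ∂μ - ∫ z, h z ∂μ) := by
  have hμ := absolutelyContinuous_of_rnDeriv_pos hw
  have hN : (0 : ℝ) < n + 1 := by positivity
  set K : Circle → ℝ := fun z =>
    ∑ j ∈ Finset.range (n + 1), ‖(orthonormalOPUC μ j).eval (z : ℂ)‖ ^ 2 with hKdef
  have hKj : ∀ j, Continuous fun z : Circle => ‖(orthonormalOPUC μ j).eval (z : ℂ)‖ ^ 2 :=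
    fun j => (continuous_eval_circle _).norm.pow 2
  have hKi : Integrable K μ := integrable_of_continuous (continuous_finsetSum _ fun j _ => hKj j)
  have hhi : Integrable h μ := integrable_of_continuous hc
  have hK : ∫ z, K z ∂μ = n + 1 := by
    rw [hKdef, integral_finsetSum _ fun j _ => integrable_of_continuous (hKj j)]
    simp_rw [integral_norm_orthonormalOPUC_sq hμ]
    simp
  have hwh := (integrable_iff_rnDeriv.1 hhi).2
  have hwK := (integrable_iff_rnDeriv.1 hKi).2
  have habs : Integrable (fun z => |1 - (μ.rnDeriv circleLebesgue z).toReal * h z|)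
      circleLebesgue := ((integrable_const (1 : ℝ)).sub hwh).abs
  have hprod := integrable_fejer_integrand (μ := μ) hc n
  have hb : Integrable (fun ζ : Circle =>
      h ζ * ∫ z : Circle, ‖(dirichletPoly n ζ).eval (z : ℂ)‖ ^ 2 ∂μ) circleLebesgue := by
    simpa only [integral_const_mul] using hprod.integral_prod_left
  have hfubini : ∫ z : Circle, 1 / ((n : ℝ) + 1) * ∫ ζ : Circle,
        h ζ * ‖(dirichletPoly n ζ).eval (z : ℂ)‖ ^ 2 ∂circleLebesgue ∂μ =
      1 / ((n : ℝ) + 1) * ∫ ζ : Circle,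
        h ζ * ∫ z : Circle, ‖(dirichletPoly n ζ).eval (z : ℂ)‖ ^ 2 ∂μ ∂circleLebesgue := by
    rw [integral_const_mul]
    simp_rw [← integral_const_mul (h _)]
    exact congrArg _ (integral_integral_swap hprod).symm
  have hpt := integral_mono
    ((((integrable_const (1 : ℝ)).sub habs).add hwh).sub (hb.const_mul (1 / ((n : ℝ) + 1))))
    (hwK.const_mul (1 / ((n : ℝ) + 1)))
    (fun ζ => one_sub_abs_add_sub_le (w := (μ.rnDeriv circleLebesgue ζ).toReal)
      ENNReal.toReal_nonneg (h0 ζ) (integral_nonneg fun _ => by positivity) hN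
      (two_mul_sub_le_sum_norm_orthonormalOPUC_sq hμ n ζ))
  rw [integral_sub' (((integrable_const (1 : ℝ)).sub habs).add hwh) (hb.const_mul _),
    integral_add' ((integrable_const (1 : ℝ)).sub habs) hwh,
    integral_sub' (integrable_const (1 : ℝ)) habs, integral_const_mul, integral_const_mul,
    integral_const] at hpt
  simp only [probReal_univ, one_smul] at hpt
  have hKdec := integral_eq_singularPart_add hKi
  have hhdec := integral_eq_singularPart_add hhi
  have hone : 1 / ((n : ℝ) + 1) * ∫ z, K z ∂μ = 1 := by
    rw [hK]
    field_simp
  rw [hKdec, mul_add] at hone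
  rw [hfubini]
  linarith

end Decomposition
end OPUC
end

theorem theorem3p3 (μ : Measure Circle) [IsFiniteMeasure μ]
    (hw : ∀ᵐ z ∂OPUC.circleLebesgue, 0 < μ.rnDeriv OPUC.circleLebesgue z) :
    Tendsto (fun n : ℕ => 1 / ((n : ℝ) + 1) *
        ∫ z : Circle, ∑ j ∈ Finset.range (n + 1),
          ‖(OPUC.orthonormalOPUC μ j).eval (z : ℂ)‖ ^ 2 ∂(μ.singularPart OPUC.circleLebesgue))
      atTop (𝓝 0) := by
  refine tendsto_order.2 ⟨fun a ha => Eventually.of_forall fun n => ha.trans_le ?_,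
    fun ε hε => ?_⟩
  · exact mul_nonneg (by positivity)
      (integral_nonneg fun _ => Finset.sum_nonneg fun _ _ => by positivity)
  obtain ⟨h, hc, h0, happ⟩ := OPUC.exists_continuous_approx_inv_rnDeriv hw (half_pos hε)
  have hM : 0 ≤ μ.real Set.univ := measureReal_nonneg
  -- The Fejér error integrates to at most ε/4 over μ; the + 1 covers μ = 0.
  filter_upwards [OPUC.eventually_fejer_le hc
    (by positivity : 0 < ε / (4 * (μ.real Set.univ + 1)))] with n hn
  refine (OPUC.integral_singularPart_le hw hc h0 n).trans_lt ?_
  have hint : ∫ z : Circle, 1 / ((n : ℝ) + 1) * ∫ ζ : Circle,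
        h ζ * ‖(OPUC.dirichletPoly n ζ).eval (z : ℂ)‖ ^ 2 ∂OPUC.circleLebesgue ∂μ ≤
      ∫ z, (h z + ε / (4 * (μ.real Set.univ + 1))) ∂μ :=
    integral_mono ((OPUC.integrable_fejer_integrand hc n).integral_prod_right.const_mul _)
      (OPUC.integrable_of_continuous (hc.add continuous_const)) hn
  rw [integral_add (OPUC.integrable_of_continuous hc) (integrable_const _), integral_const,
    smul_eq_mul] at hint
  have hsmall : μ.real Set.univ * (ε / (4 * (μ.real Set.univ + 1))) ≤ ε / 4 := by
    rw [mul_div_assoc', div_le_div_iff₀ (by positivity) (by norm_num)]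
    nlinarith
  linarith
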